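/- Let $n\ge 1$, let $q,a,A,B,x_1,\dots,x_n$ be non-zero complex numbers with $|q|<1$, let $N_1,\dots,N_n$ be non-negative integers, and let $A_{\boldsymbol j}$, indexed by $\boldsymbol j=(j_1,\dots,j_n)$ with $j_1,\dots,j_n$ non-negative integers, be arbitrary complex numbers. Write $(c)_k=\prod_{i=0}^{k-1}(1-cq^i)$ and $|\boldsymbol k|=k_1+\cdots+k_n$ for $\boldsymbol k=(k_1,\dots,k_n)$, and similarly for $|\boldsymbol j|$ and $|\boldsymbol N|$. Assume that none of the denominators below vanishes. Then $$ \begin{aligned} &\frac{(aAB/q)_{|\boldsymbol N|}}{(aA)_{|\boldsymbol N|}}\prod_{r=1}^n\frac{(aqx_r)_{N_r}}{(aBx_r)_{N_r}} \sum_{\substack{0\le j_r\le N_r\\ r=1,\dots,n}}\ \prod_{1\le r<s\le n}\frac{1-q^{j_r-j_s}x_r/x_s}{1-x_r/x_s}\prod_{r,s=1}^n (q^{-N_s}x_r/x_s)_{j_r}\\ &\qquad\qquad\times\prod_{r=1}^n (qx_r/A)_{j_r}\;\frac{(q/B)_{|\boldsymbol j|}}{(q^{2-|\boldsymbol N|}/aAB)_{|\boldsymbol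 j|}}\;q^{\sum_{r=1}^n r j_r}A_{\boldsymbol j}\\ &=\sum_{\substack{0\le k_r\le N_r\\ r=1,\dots,n}}\ \prod_{1\le r<s\le n}\frac{1-q^{k_r-k_s}x_r/x_s}{1-x_r/x_s}\prod_{r,s=1}^n\frac{(q^{-N_s}x_r/x_s)_{k_r}}{(qx_r/x_s)_{k_r}}\\ &\qquad\times\prod_{r=1}^n\frac{(1-ax_rq^{k_r+|\boldsymbol k|})\,(ax_r)_{|\boldsymbol k|}\,(qx_r/A)_{k_r}}{(1-ax_r)\,(ax_rq^{1+N_r})_{|\boldsymbol k|}\,(aBx_r)_{k_r}}\; \frac{(q/B)_{|\boldsymbol k|}}{(aA)_{|\boldsymbol k|}}\,\bigl(aABq^{|\boldsymbol N|-1}\bigr)^{|\boldsymbol k|}q^{\sum_{r=1}^n(r-1)k_r}\\ &\qquad\times\sum_{\substack{0\le j_r\le k_r\\ r=1,\dots,n}}\ \prod_{1\le r<s\le n}\frac{1-q^{j_r-j_s}x_r/x_s}{1-x_r/x_s}\prod_{r,s=1}^n(q^{-k_s}x_r/x_s)_{j_r}\prod_{r=1}^n(ax_rq^{|\boldsymbol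 k|})_{j_r}\;q^{\sum_{r=1}^n r j_r}A_{\boldsymbol j}. \end{aligned} $$ -/

import Mathlib

open scoped BigOperators

/-- The `q`-rising factorial `(c; q)_k = (1 - c) (1 - c q) ⋯ (1 - c q^(k-1))`. -/
def qRising (q c : ℂ) (k : ℕ) : ℂ :=
  ∏ i ∈ Finset.range k, (1 - c * q ^ i)

/-- `|k| = k_1 + ⋯ + k_n`. -/
def multiSum {n : ℕ} (k : Fin n → ℕ) : ℕ :=
  ∑ r, k r

/-- The type `A` Vandermonde factor
`∏_{1 ≤ r < s ≤ n} (1 - q^(k_r - k_s) x_r / x_s) / (1 - x_r / x_s)`. -/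
noncomputable def vandermondeA {n : ℕ} (q : ℂ) (x : Fin n → ℂ) (k : Fin n → ℕ) : ℂ :=
  ∏ r : Fin n, ∏ s ∈ Finset.Ioi r,
    (1 - q ^ ((k r : ℤ) - (k s : ℤ)) * (x r / x s)) / (1 - x r / x s)

/-!
The `α j` are arbitrary, so the identity amounts to the equality of the coefficients of each `α j`.
After the two summations on the right are exchanged, the coefficient of `α j` there is a sum over
`k` with `j ≤ k ≤ N`. Putting `k = j + l` turns it into a multiple of the terminating
very-well-poised `₆φ₅` sum over `A_n` with `a`, `b = q / B`, `x_r`, `N` replaced by `a q^|j|`,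
`b q^|j|`, `x_r q^(j_r)`, `N - j`, while `c = q / A` and `d = a B = a q / b` do not change
(`summand_shift`). The type `A` products are matched by `vandermondeA_mul_prod`, which says that
they combine to a monomial in `q`, one pair of indices at a time (`pair_monomial`).

The `₆φ₅` sum (`sum_wellPoised`) is proved by induction on `|N|`. Its summand is symmetric in the
`n + 1` parameters `c` and `q^(-N_s) / x_s`. Multiplied by `c^|N| (aq/c)_|N|`, both sides are
polynomials in `c` of degree at most `|N|`, and it suffices to compare them at `|N| + 1` points. At
the `|N|` points `c = q^(-m) / x_r` with `m < N_r`, the symmetry allows `m` and `N_r` to change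
places, which gives the identity with `N_r` replaced by `m` (`sum_at_node`, `prod_at_node`). At
`c = a q^|N|` only the summand `k = N` survives (`wellPoisedPoly_eval_last`).

These points are distinct, and the shifted sums have no vanishing denominators, as long as no
`a x_r q^i` equals `1`. This excludes countably many `a`, and the identity extends to them because
both sides are continuous in `a` wherever their denominators do not vanish.
-/

/-! ### Rising `q`-factorials -/

@[simp] lemma qRising_zero (q c : ℂ) : qRising q c 0 = 1 := by simp [qRising]

lemma qRising_add (q c : ℂ) (m n : ℕ) :
    qRising q c (m + n) = qRising q c m * qRising q (c * q ^ m) n := by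
  simp only [qRising, Finset.prod_range_add, pow_add, mul_assoc]

lemma qRising_succ (q c : ℂ) (n : ℕ) :
    qRising q c (n + 1) = qRising q c n * (1 - c * q ^ n) := by
  simp only [qRising, Finset.prod_range_succ]

lemma qRising_succ_left (q c : ℂ) (n : ℕ) :
    qRising q c (n + 1) = (1 - c) * qRising q (c * q) n := by
  rw [add_comm, qRising_add]; simp [qRising]

lemma qRising_ne_zero_iff {q c : ℂ} {k : ℕ} :
    qRising q c k ≠ 0 ↔ ∀ i < k, 1 - c * q ^ i ≠ 0 := by
  simp [qRising, Finset.prod_ne_zero_iff]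

lemma qRising_ne_zero_of_le {q c : ℂ} {k m : ℕ} (h : qRising q c k ≠ 0) (hm : m ≤ k) :
    qRising q c m ≠ 0 :=
  qRising_ne_zero_iff.2 fun i hi => qRising_ne_zero_iff.1 h i (hi.trans_le hm)

/-- Reversal of the order of the factors: `w` is `q^(1-j) / u`. -/
lemma qRising_reverse {q u w : ℂ} {j : ℕ} (hq : q ≠ 0) (h : u * w * q ^ j = q) :
    qRising q u j = (-u) ^ j * q ^ (j.choose 2) * qRising q w j := by
  have e : ∏ i ∈ Finset.range j, ((-u) * q ^ i) = (-u) ^ j * q ^ (j.choose 2) := by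
    rw [Finset.prod_mul_distrib, Finset.prod_const, Finset.card_range, Finset.prod_pow_eq_pow_sum,
      Finset.sum_range_id, Nat.choose_two_right]
  rw [← e, qRising, qRising, ← Finset.prod_range_reflect (fun i => 1 - w * q ^ i),
    ← Finset.prod_mul_distrib]
  refine Finset.prod_congr rfl fun i hi => ?_
  obtain ⟨t, rfl⟩ : ∃ t, j = i + t + 1 :=
    ⟨j - i - 1, by have := Finset.mem_range.1 hi; omega⟩
  have h1 : u * w * q ^ (i + t) = 1 := by
    apply mul_right_cancel₀ hq; rw [one_mul]; rw [pow_succ] at h; linear_combination h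
  rw [show i + t + 1 - 1 - i = t by omega]
  rw [pow_add] at h1
  linear_combination -h1

/-- Two ways of splitting `(u)_(m+T)`. -/
lemma qRising_split_comm (q u : ℂ) {m n S T : ℕ} (h : m + T = n + S) :
    qRising q u m * qRising q (u * q ^ m) T = qRising q u n * qRising q (u * q ^ n) S := by
  rw [← qRising_add, ← qRising_add, h]

lemma choose_two_add (m d : ℕ) : (m + d).choose 2 = m.choose 2 + d.choose 2 + m * d := by
  induction d with
  | zero => simp
  | succ d ih =>
    rw [← add_assoc, Nat.choose_succ_succ' (m + d) 1, Nat.choose_succ_succ' d 1, ih]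
    simp only [Nat.choose_one_right]; ring

lemma two_mul_choose_two (t : ℕ) : t.choose 2 + t.choose 2 + t = t * t := by
  induction t with
  | zero => simp
  | succ t ih =>
    rw [Nat.choose_succ_succ' t 1, Nat.choose_one_right]
    linarith

/-! ### Evaluation of the type `A` products -/

/-- The case `j = m + d`, `j' = m` of `pair_monomial`. Once the order of the factors is reversed
where `q` has negative exponents, all products telescope. -/
lemma pair_monomial_aux {q z : ℂ} (hq : q ≠ 0) (hz : z ≠ 0) (m d l l' : ℕ) :
    (1 - q ^ d * z) * qRising q ((q ^ (m + l'))⁻¹ * z) (m + d) * qRising q (q * q ^ d * z) l *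
      qRising q ((q ^ (m + d + l))⁻¹ * z⁻¹) m * qRising q (q * (q ^ d)⁻¹ * z⁻¹) l' *
      q ^ (l * m + l' * (m + d) + (m + d) * m + m) =
    (1 - z) * qRising q (q * z) (m + d + l) * qRising q (q * z⁻¹) (m + l') := by
  have hp : ∀ n : ℕ, q ^ n ≠ 0 := fun n => pow_ne_zero _ hq
  have r1 := qRising_reverse (q := q) (u := q * q ^ d * z * q ^ l)
    (w := (q ^ (m + d + l))⁻¹ * z⁻¹) (j := m) hq (by simp only [pow_add]; field_simp)
  have r2 := qRising_reverse (q := q) (u := q * (q ^ d)⁻¹ * z⁻¹ * q ^ l')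
    (w := (q ^ (m + l'))⁻¹ * z) (j := m + d) hq (by simp only [pow_add]; field_simp)
  have r3 := qRising_reverse (q := q) (u := z) (w := q * (q ^ d)⁻¹ * z⁻¹) (j := d) hq
    (by field_simp)
  have s1 : qRising q (q * z) (m + d + l) = qRising q (q * z) d *
      (qRising q (q * q ^ d * z) l * qRising q (q * q ^ d * z * q ^ l) m) := by
    rw [← qRising_add, show m + d + l = d + (l + m) by ring, qRising_add]
    congr 2; ring
  have s2 : qRising q (q * (q ^ d)⁻¹ * z⁻¹) l' *
      qRising q (q * (q ^ d)⁻¹ * z⁻¹ * q ^ l') (m + d) =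
      qRising q (q * (q ^ d)⁻¹ * z⁻¹) d * qRising q (q * z⁻¹) (m + l') := by
    rw [← qRising_add, show l' + (m + d) = d + (m + l') by ring, qRising_add]
    congr 2; field_simp
  have s3 : (1 - q ^ d * z) * qRising q z d = (1 - z) * qRising q (q * z) d := by
    rw [mul_comm q z, ← qRising_succ_left, qRising_succ]; ring
  rw [s1, r1]
  rw [r2] at s2
  rw [r3] at s3
  rw [choose_two_add] at s2
  generalize qRising q (q * (q ^ d)⁻¹ * z⁻¹) d = X at *
  generalize qRising q ((q ^ (m + l'))⁻¹ * z) (m + d) = Y at *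
  generalize qRising q (q * q ^ d * z) l = Z at *
  generalize qRising q ((q ^ (m + d + l))⁻¹ * z⁻¹) m = W at *
  generalize qRising q (q * z) d = U at *
  generalize qRising q (q * (q ^ d)⁻¹ * z⁻¹) l' = T at *
  -- the powers of `-1` and `z` cancel once the three monomials are grouped by exponent
  have c1 : (-(q * (q ^ d)⁻¹ * z⁻¹ * q ^ l')) ^ (m + d) *
        q ^ (m.choose 2 + d.choose 2 + m * d) * ((-(q * q ^ d * z * q ^ l)) ^ m *
          q ^ m.choose 2) * ((-z) ^ d * q ^ d.choose 2) =
      q ^ (l * m + l' * (m + d) + (m + d) * m + m) := by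
    have e1 : (-(q * (q ^ d)⁻¹ * z⁻¹ * q ^ l')) * (-(q * q ^ d * z * q ^ l)) =
        q ^ (2 + l + l') := by
      simp only [pow_add]; field_simp
    have e2 : (-(q * (q ^ d)⁻¹ * z⁻¹ * q ^ l')) * (-z) * q ^ d = q ^ (1 + l') := by
      simp only [pow_add]; field_simp
    have hm := two_mul_choose_two m
    have hd := two_mul_choose_two d
    apply mul_right_cancel₀ (pow_ne_zero d (hp d))
    calc _ = ((-(q * (q ^ d)⁻¹ * z⁻¹ * q ^ l')) * (-(q * q ^ d * z * q ^ l))) ^ m *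
          ((-(q * (q ^ d)⁻¹ * z⁻¹ * q ^ l')) * (-z) * q ^ d) ^ d *
          q ^ (m.choose 2 + m.choose 2 + d.choose 2 + d.choose 2 + m * d) := by
            simp only [mul_pow, pow_add]; ring
      _ = q ^ (l * m + l' * (m + d) + (m + d) * m + m + d * d) := by
            rw [e1, e2, ← pow_mul, ← pow_mul, ← pow_add, ← pow_add]
            congr 1
            linarith
      _ = _ := by rw [pow_add _ _ (d * d), pow_mul q d d]
  rw [← c1]
  linear_combination
    ((1 - q ^ d * z) * Z * W * ((-(q * q ^ d * z * q ^ l)) ^ m * q ^ m.choose 2) *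
      ((-z) ^ d * q ^ d.choose 2)) * s2 +
    (Z * W * ((-(q * q ^ d * z * q ^ l)) ^ m * q ^ m.choose 2) *
      qRising q (q * z⁻¹) (m + l')) * s3

/-- The contribution of a pair `r < s` with `x_r / x_s = z` to the type `A` product: it is a
monomial times quantities that depend on `j + l` and `j' + l'` only. -/
lemma pair_monomial {q z : ℂ} (hq : q ≠ 0) (hz : z ≠ 0) (j l j' l' : ℕ) :
    (1 - q ^ ((j : ℤ) - j') * z) * qRising q (q ^ (-((j' + l' : ℕ) : ℤ)) * z) j *
      qRising q (q * q ^ ((j : ℤ) - j') * z) l *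
      qRising q (q ^ (-((j + l : ℕ) : ℤ)) * z⁻¹) j' *
      qRising q (q * q ^ ((j' : ℤ) - j) * z⁻¹) l' *
      q ^ (l * j' + l' * j + j * j' + j') =
    (1 - z) * qRising q (q * z) (j + l) * qRising q (q * z⁻¹) (j' + l') := by
  rcases le_total j' j with h | h
  · obtain ⟨d, rfl⟩ := Nat.exists_eq_add_of_le h
    have := pair_monomial_aux hq hz j' d l l'
    simpa only [show ((j' + d : ℕ) : ℤ) - j' = (d : ℤ) by push_cast; ring,
      show (j' : ℤ) - ((j' + d : ℕ) : ℤ) = -(d : ℤ) by push_cast; ring, zpow_neg, zpow_natCast]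
      using this
  · obtain ⟨d, rfl⟩ := Nat.exists_eq_add_of_le h
    have := pair_monomial_aux hq (inv_ne_zero hz) j d l' l
    rw [inv_inv] at this
    simp only [show ((j + d : ℕ) : ℤ) - j = (d : ℤ) by push_cast; ring,
      show (j : ℤ) - ((j + d : ℕ) : ℤ) = -(d : ℤ) by push_cast; ring, zpow_neg, zpow_natCast]
    -- exchanging the two indices multiplies the Vandermonde quotient by a power of `q`
    have e1 : 1 - (q ^ d)⁻¹ * z = -(z * (q ^ d)⁻¹) * (1 - q ^ d * z⁻¹) := by
      have := pow_ne_zero d hq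
      field_simp; ring
    have e2 : 1 - z⁻¹ = -(z⁻¹) * (1 - z) := by field_simp; ring
    have e3 : q ^ (l * (j + d) + l' * j + j * (j + d) + (j + d)) =
        q ^ (l' * j + l * (j + d) + (j + d) * j + j) * q ^ d := by ring
    rw [e2] at this
    rw [e1, e3]
    have hd := pow_ne_zero d hq
    have e4 : z * z⁻¹ = 1 := mul_inv_cancel₀ hz
    have e5 : q ^ d * (q ^ d)⁻¹ = 1 := mul_inv_cancel₀ hd
    linear_combination (-(z * (q ^ d)⁻¹ * q ^ d)) * this +
      ((1 - z) * qRising q (q * z) (j + l) * qRising q (q * z⁻¹) (j + d + l') *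
        (q ^ d * (q ^ d)⁻¹)) * e4 +
      ((1 - z) * qRising q (q * z) (j + l) * qRising q (q * z⁻¹) (j + d + l')) * e5

/-- The contribution of a diagonal pair `r = s` to the type `A` product. -/
lemma diag_monomial {q : ℂ} (hq : q ≠ 0) (j l : ℕ) :
    qRising q (q ^ (-((j + l : ℕ) : ℤ)) * 1) j * qRising q (q * 1) l *
      q ^ (l * j + (j + 1).choose 2) = (-1) ^ j * qRising q (q * 1) (j + l) := by
  generalize hw : q ^ (-((j + l : ℕ) : ℤ)) * 1 = w
  have r1 := qRising_reverse (q := q) (u := q * 1 * q ^ l) (w := w) (j := j) hq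
    (by rw [← hw, zpow_neg, zpow_natCast, pow_add]; field_simp)
  have e : (-1 : ℂ) ^ j * (-1) ^ j = 1 := by rw [← mul_pow]; simp
  have c : (j + 1).choose 2 = j + j.choose 2 := by
    rw [Nat.choose_succ_succ' j 1, Nat.choose_one_right]
  have a1 : qRising q (q * 1) (j + l) = qRising q (q * 1) l * qRising q (q * 1 * q ^ l) j := by
    rw [add_comm, qRising_add]
  rw [a1, r1, c, neg_pow (q * 1 * q ^ l)]
  simp only [mul_pow, mul_one, pow_add, pow_mul]
  linear_combination (-(qRising q q l * qRising q w j * (q ^ l) ^ j * q ^ j * q ^ j.choose 2)) * e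

lemma multiSum_add {n : ℕ} (k l : Fin n → ℕ) : multiSum (k + l) = multiSum k + multiSum l := by
  simp [multiSum, Finset.sum_add_distrib]

lemma multiSum_mono {n : ℕ} {k l : Fin n → ℕ} (h : k ≤ l) : multiSum k ≤ multiSum l :=
  Finset.sum_le_sum fun r _ => h r

lemma sum_Ioi_add_sum_diag {n : ℕ} (j l : Fin n → ℕ) :
    ∑ r, ∑ s ∈ Finset.Ioi r, (l r * j s + l s * j r) + ∑ r, l r * j r =
      multiSum l * multiSum j := by
  have := Finset.sum_sum_Ioi_add_eq_sum_sum_off_diag (fun s r => l r * j s)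
  rw [this, ← Finset.sum_add_distrib, multiSum, multiSum, Finset.sum_mul_sum]
  refine Finset.sum_congr rfl fun r _ => ?_
  rw [add_comm, Finset.compl_singleton,
    Finset.add_sum_erase _ (fun s => l r * j s) (Finset.mem_univ r)]

lemma choose_two_sum {n : ℕ} (j : Fin n → ℕ) :
    (multiSum j + 1).choose 2 =
      ∑ r, ∑ s ∈ Finset.Ioi r, j r * j s + ∑ r, (j r + 1).choose 2 := by
  have h := sum_Ioi_add_sum_diag j j
  have h0 := two_mul_choose_two (multiSum j)
  have h1 : ∑ r, ((j r).choose 2 + (j r).choose 2 + j r) = ∑ r, j r * j r :=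
    Finset.sum_congr rfl fun r _ => two_mul_choose_two (j r)
  simp only [Nat.choose_succ_succ' _ 1, Nat.choose_one_right, Finset.sum_add_distrib] at *
  have h2 : ∑ r, ∑ s ∈ Finset.Ioi r, j s * j r = ∑ r, ∑ s ∈ Finset.Ioi r, j r * j s := by
    simp only [mul_comm]
  have h3 : multiSum j = ∑ r, j r := rfl
  linarith

/-- The exponents of `q` in `pair_monomial` and `diag_monomial` add up to a function of `|j|`, `|l|`
and `∑ r j_r`. -/
lemma exponent_sum {n : ℕ} (j l : Fin n → ℕ) :
    ∑ r, ∑ s ∈ Finset.Ioi r, (l r * j s + l s * j r + j r * j s + j s) +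
      ∑ r, (l r * j r + (j r + 1).choose 2) =
    multiSum l * multiSum j + (multiSum j + 1).choose 2 + ∑ r : Fin n, (r : ℕ) * j r := by
  have h1 := sum_Ioi_add_sum_diag j l
  have h2 : ∑ r : Fin n, ∑ s ∈ Finset.Ioi r, j s = ∑ r : Fin n, (r : ℕ) * j r := by
    rw [Finset.sum_comm' (t' := Finset.univ) (s' := fun s => Finset.Iio s) (by simp)]
    simp
  rw [choose_two_sum, ← h1, ← h2]
  simp only [Finset.sum_add_distrib]
  ring

/-- Evaluation of the type `A` product that appears when the summation index is shifted by `j`. With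
`l = 0` it also evaluates the last summand `k = N` of the `₆φ₅` sum. -/
lemma vandermondeA_mul_prod {n : ℕ} {q : ℂ} {x : Fin n → ℂ} (hq : q ≠ 0) (hx : ∀ r, x r ≠ 0)
    (hV : ∀ r s, r < s → 1 - x r / x s ≠ 0) (j l : Fin n → ℕ) :
    vandermondeA q x j *
      (∏ r, ∏ s, qRising q (q ^ (-((j s + l s : ℕ) : ℤ)) * (x r / x s)) (j r) *
        qRising q (q * q ^ ((j r : ℤ) - j s) * (x r / x s)) (l r)) *
      q ^ (multiSum l * multiSum j + (multiSum j + 1).choose 2 + ∑ r : Fin n, (r : ℕ) * j r) =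
    (-1) ^ multiSum j * ∏ r, ∏ s, qRising q (q * (x r / x s)) (j r + l r) := by
  -- a product over all pairs `(r, s)` is regrouped by unordered pairs and the diagonal
  have split : ∀ f : Fin n → Fin n → ℂ, ∏ r, ∏ s, f r s =
      (∏ r, ∏ s ∈ Finset.Ioi r, f r s * f s r) * ∏ r, f r r := by
    intro f
    have := Finset.prod_prod_Ioi_mul_eq_prod_prod_off_diag (fun s r => f r s)
    rw [this, ← Finset.prod_mul_distrib]
    refine Finset.prod_congr rfl fun r _ => ?_
    rw [mul_comm, Finset.compl_singleton,
      Finset.mul_prod_erase _ (fun s => f r s) (Finset.mem_univ r)]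
  rw [split, split, ← exponent_sum, pow_add, multiSum, ← Finset.prod_pow_eq_pow_sum,
    ← Finset.prod_pow_eq_pow_sum, ← Finset.prod_pow_eq_pow_sum]
  simp only [← Finset.prod_pow_eq_pow_sum]
  rw [vandermondeA]
  have hp : ∀ r, ∀ s ∈ Finset.Ioi r, ((1 - q ^ ((j r : ℤ) - (j s : ℤ)) * (x r / x s)) /
      (1 - x r / x s)) * ((qRising q (q ^ (-((j s + l s : ℕ) : ℤ)) * (x r / x s)) (j r) *
        qRising q (q * q ^ ((j r : ℤ) - j s) * (x r / x s)) (l r)) *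
      (qRising q (q ^ (-((j r + l r : ℕ) : ℤ)) * (x s / x r)) (j s) *
        qRising q (q * q ^ ((j s : ℤ) - j r) * (x s / x r)) (l s))) *
      q ^ (l r * j s + l s * j r + j r * j s + j s) =
      qRising q (q * (x r / x s)) (j r + l r) * qRising q (q * (x s / x r)) (j s + l s) := by
    intro r s hs
    have h1 := hV r s (Finset.mem_Ioi.1 hs)
    have := pair_monomial hq (div_ne_zero (hx r) (hx s)) (j r) (l r) (j s) (l s)
    rw [inv_div] at this
    rw [div_mul_eq_mul_div, div_mul_eq_mul_div, div_eq_iff h1]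
    linear_combination this
  have hd : ∀ r, qRising q (q ^ (-((j r + l r : ℕ) : ℤ)) * (x r / x r)) (j r) *
        qRising q (q * q ^ ((j r : ℤ) - j r) * (x r / x r)) (l r) *
        q ^ (l r * j r + (j r + 1).choose 2) =
      (-1) ^ j r * qRising q (q * (x r / x r)) (j r + l r) := by
    intro r
    rw [sub_self, zpow_zero, mul_one, div_self (hx r)]
    exact diag_monomial hq (j r) (l r)
  have hp' := Finset.prod_congr rfl fun r (_ : r ∈ Finset.univ) => Finset.prod_congr rfl (hp r)
  have hd' := Finset.prod_congr rfl fun r (_ : r ∈ Finset.univ) => hd r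
  simp only [Finset.prod_mul_distrib] at hp' hd' ⊢
  linear_combination congrArg₂ (· * ·) hp' hd'

/-! ### The terminating very-well-poised `₆φ₅` sum over `A_n` -/

/-- The factor of the summand of the `₆φ₅` sum that belongs to one parameter `u`. The summand is
symmetric in the `n + 1` parameters `u = c` and `u = q^(-N_s) / x_s`. -/
noncomputable def nodeFactor {n : ℕ} (q a : ℂ) (x : Fin n → ℂ) (k : Fin n → ℕ) (u : ℂ) : ℂ :=
  (∏ r, qRising q (u * x r) (k r)) / (u ^ multiSum k * qRising q (a * q / u) (multiSum k))

/-- The part of the summand of the `₆φ₅` sum that depends neither on `c` nor on `N`. -/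
noncomputable def wellPoisedWeight {n : ℕ} (q a b d : ℂ) (x : Fin n → ℂ) (k : Fin n → ℕ) : ℂ :=
  vandermondeA q x k * (∏ r, ∏ s, qRising q (q * (x r / x s)) (k r))⁻¹ *
    (∏ r, ((1 - a * x r * q ^ (k r + multiSum k)) * qRising q (a * x r) (multiSum k)) /
      ((1 - a * x r) * qRising q (d * x r) (k r))) *
    qRising q b (multiSum k) * d ^ multiSum k * q ^ (∑ r : Fin n, (r : ℕ) * k r) *
    ∏ s, (x s ^ multiSum k)⁻¹

/-- The summand of the `₆φ₅` sum, without the factor of the parameter `c`. -/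
noncomputable def wellPoisedCoeff {n : ℕ} (q a b d : ℂ) (x : Fin n → ℂ) (N k : Fin n → ℕ) : ℂ :=
  wellPoisedWeight q a b d x k * ∏ s, nodeFactor q a x k ((q ^ N s * x s)⁻¹)

/-- The product in the evaluation of the `₆φ₅` sum that does not depend on `c`. -/
noncomputable def wellPoisedProd {n : ℕ} (q a d : ℂ) (x : Fin n → ℂ) (N : Fin n → ℕ) : ℂ :=
  ∏ r, qRising q (a * q * x r) (N r) / qRising q (d * x r) (N r)

section SixPhiFive

variable {n : ℕ} {q a b d : ℂ} {x : Fin n → ℂ}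

lemma prod_Ico_sub {c : ℂ} (hc : c ≠ 0) {m M : ℕ} (h : m ≤ M) :
    (∏ i ∈ Finset.Ico m M, (c - a * q * q ^ i)) * (c ^ m * qRising q (a * q / c) m) =
      c ^ M * qRising q (a * q / c) M := by
  obtain ⟨t, rfl⟩ := Nat.exists_eq_add_of_le h
  have : ∏ i ∈ Finset.Ico m (m + t), (c - a * q * q ^ i) =
      c ^ t * qRising q (a * q / c * q ^ m) t := by
    rw [Finset.prod_Ico_eq_prod_range, Nat.add_sub_cancel_left, qRising]
    conv_rhs => rw [← Finset.card_range t, ← Finset.prod_const, Finset.card_range,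
      ← Finset.prod_mul_distrib]
    refine Finset.prod_congr rfl fun i _ => ?_
    rw [pow_add]; field_simp
  rw [this, qRising_add, pow_add]; ring

/-- The difference of the two sides of the `₆φ₅` evaluation, cleared of denominators in the
parameter `c`, which is the variable of the polynomial. -/
noncomputable def wellPoisedPoly (q a b d : ℂ) (x : Fin n → ℂ) (N : Fin n → ℕ) : Polynomial ℂ :=
  ∑ k ∈ Finset.Iic N, Polynomial.C (wellPoisedCoeff q a b d x N k) *
    ((∏ r, ∏ i ∈ Finset.range (k r), (1 - Polynomial.C (x r * q ^ i) * Polynomial.X)) *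
    ∏ i ∈ Finset.Ico (multiSum k) (multiSum N),
      (Polynomial.X - Polynomial.C (a * q * q ^ i))) -
  Polynomial.C (wellPoisedProd q a d x N) *
    ∏ i ∈ Finset.range (multiSum N), (Polynomial.X - Polynomial.C (d * q ^ i))

open Polynomial in
lemma wellPoisedPoly_degree (N : Fin n → ℕ) :
    (wellPoisedPoly q a b d x N).degree ≤ multiSum N := by
  have hX : ∀ (u : ℂ), (X - C u : ℂ[X]).degree ≤ ((1 : ℕ) : WithBot ℕ) := fun u => by
    rw [degree_X_sub_C]; rfl
  have hY : ∀ (u : ℂ), (1 - C u * X : ℂ[X]).degree ≤ ((1 : ℕ) : WithBot ℕ) := fun u => by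
    refine (degree_sub_le _ _).trans (max_le (degree_one_le.trans (by simp)) ?_)
    simpa using degree_C_mul_X_le u
  have hprod : ∀ {ι : Type} (t : Finset ι) (f : ι → ℂ[X]) (g : ι → ℕ),
      (∀ i ∈ t, (f i).degree ≤ (g i : WithBot ℕ)) →
      (∏ i ∈ t, f i).degree ≤ ((∑ i ∈ t, g i : ℕ) : WithBot ℕ) := fun t f g h => by
    refine (degree_prod_le t f).trans ?_
    push_cast
    exact Finset.sum_le_sum h
  have hC : ∀ (u : ℂ) (p : ℂ[X]) (m : ℕ), p.degree ≤ m → (C u * p).degree ≤ (m : WithBot ℕ) :=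
    fun u p m h => (degree_mul_le _ _).trans
      ((add_le_add degree_C_le h).trans (by simp))
  refine (degree_sub_le _ _).trans (max_le ?_ (hC _ _ _ ?_))
  · refine (degree_sum_le _ _).trans (Finset.sup_le fun k hk => hC _ _ _ ?_)
    have hk := multiSum_mono (Finset.mem_Iic.1 hk)
    refine (degree_mul_le _ _).trans ((add_le_add (hprod _ _ k fun r _ => ?_)
      (hprod _ _ (fun _ => 1) fun i _ => hX _)).trans ?_)
    · exact (hprod _ _ (fun _ => 1) fun i _ => hY _).trans (by simp)
    · simp only [Finset.sum_const, Nat.card_Ico, smul_eq_mul, mul_one]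
      rw [← Nat.cast_add]
      norm_cast
      change multiSum k + _ ≤ _
      omega
  · exact (hprod _ _ (fun _ => 1) fun i _ => hX _).trans (by simp)

/-- The denominators cleared are those of `nodeFactor q a x k c` and of the evaluation. -/
lemma wellPoisedPoly_eval (N : Fin n → ℕ) {c : ℂ} (hc : c ≠ 0)
    (he : qRising q (a * q / c) (multiSum N) ≠ 0) :
    (wellPoisedPoly q a b d x N).eval c = c ^ multiSum N * qRising q (a * q / c) (multiSum N) *
      (∑ k ∈ Finset.Iic N, wellPoisedCoeff q a b d x N k * nodeFactor q a x k c -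
        qRising q (d / c) (multiSum N) / qRising q (a * q / c) (multiSum N) *
          wellPoisedProd q a d x N) := by
  rw [wellPoisedPoly, Polynomial.eval_sub, Polynomial.eval_finsetSum, mul_sub, Finset.mul_sum]
  congr 1
  · refine Finset.sum_congr rfl fun k hk => ?_
    have hk := multiSum_mono (Finset.mem_Iic.1 hk)
    have h0 := qRising_ne_zero_of_le he hk
    have h1 := prod_Ico_sub (q := q) (a := a) hc hk
    simp only [Polynomial.eval_mul, Polynomial.eval_C, Polynomial.eval_prod, Polynomial.eval_sub,
      Polynomial.eval_one, Polynomial.eval_X]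
    have h2 : ∀ r, ∏ i ∈ Finset.range (k r), (1 - x r * q ^ i * c) = qRising q (c * x r) (k r) :=
      fun r => Finset.prod_congr rfl fun i _ => by ring
    simp only [h2]
    rw [← h1, nodeFactor]
    have := pow_ne_zero (multiSum k) hc
    field_simp
  · simp only [Polynomial.eval_mul, Polynomial.eval_C, Polynomial.eval_prod, Polynomial.eval_sub,
      Polynomial.eval_X]
    have h2 : ∏ i ∈ Finset.range (multiSum N), (c - d * q ^ i) =
        c ^ multiSum N * qRising q (d / c) (multiSum N) := by
      rw [qRising]
      conv_rhs => rw [← Finset.card_range (multiSum N), ← Finset.prod_const, Finset.card_range,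
        ← Finset.prod_mul_distrib]
      refine Finset.prod_congr rfl fun i _ => ?_
      field_simp
    rw [h2]
    field_simp

lemma qRising_inv_pow_eq_zero (hq : q ≠ 0) {m k : ℕ} (h : m < k) :
    qRising q ((q ^ m)⁻¹) k = 0 := by
  refine Finset.prod_eq_zero (Finset.mem_range.2 h) ?_
  rw [inv_mul_cancel₀ (pow_ne_zero _ hq), sub_self]

/-- At `c = q^(-m) / x_r` with `m < N_r` the parameters `c` and `q^(-N_r) / x_r` change places:
both sides become those with `N_r` replaced by `m`. -/
lemma sum_at_node (hq : q ≠ 0) (hx : ∀ r, x r ≠ 0) (N : Fin n → ℕ) (r : Fin n) {m : ℕ}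
    (hm : m < N r) :
    ∑ k ∈ Finset.Iic N, wellPoisedCoeff q a b d x N k * nodeFactor q a x k ((q ^ m * x r)⁻¹) =
    ∑ k ∈ Finset.Iic (Function.update N r m),
      wellPoisedCoeff q a b d x (Function.update N r m) k *
        nodeFactor q a x k ((q ^ N r * x r)⁻¹) := by
  have hle : Function.update N r m ≤ N := by
    intro s; rcases eq_or_ne s r with rfl | h
    · simpa using hm.le
    · simp [h]
  rw [← Finset.sum_subset (Finset.Iic_subset_Iic.2 hle)]
  · refine Finset.sum_congr rfl fun k _ => ?_
    simp only [wellPoisedCoeff]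
    rw [← Finset.mul_prod_erase _ _ (Finset.mem_univ r),
      ← Finset.mul_prod_erase _ (fun s => nodeFactor q a x k
        ((q ^ (Function.update N r m s) * x s)⁻¹)) (Finset.mem_univ r)]
    have : ∏ s ∈ Finset.univ.erase r, nodeFactor q a x k
        ((q ^ (Function.update N r m s) * x s)⁻¹) =
        ∏ s ∈ Finset.univ.erase r, nodeFactor q a x k ((q ^ N s * x s)⁻¹) :=
      Finset.prod_congr rfl fun s hs => by
        rw [Function.update_of_ne (Finset.ne_of_mem_erase hs)]
    rw [this, Function.update_self]
    ring
  · intro k hk hk'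
    -- `(q^(-m))_(k_r) = 0` removes the summands with `k_r > m`
    have hkr : m < k r := by
      by_contra h
      refine hk' (Finset.mem_Iic.2 fun s => ?_)
      rcases eq_or_ne s r with rfl | h'
      · simpa using h
      · simpa [h'] using Finset.mem_Iic.1 hk s
    have h0 : ∏ s, qRising q ((q ^ m * x r)⁻¹ * x s) (k s) = 0 := by
      refine Finset.prod_eq_zero (Finset.mem_univ r) ?_
      rw [mul_inv, inv_mul_cancel_right₀ (hx r)]
      exact qRising_inv_pow_eq_zero hq hkr
    rw [nodeFactor, h0, zero_div, mul_zero]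

lemma multiSum_update (N : Fin n → ℕ) (r : Fin n) (m : ℕ) :
    m + multiSum N = N r + multiSum (Function.update N r m) := by
  simp only [multiSum]
  rw [← Finset.add_sum_erase _ _ (Finset.mem_univ r),
    ← Finset.add_sum_erase _ (Function.update N r m) (Finset.mem_univ r), Function.update_self,
    Finset.sum_congr (g := N) rfl fun s hs =>
      Function.update_of_ne (Finset.ne_of_mem_erase hs) m N]
  ring

/-- The product side at `c = q^(-m) / x_r`, the counterpart of `sum_at_node`. -/
lemma prod_at_node (N : Fin n → ℕ) (r : Fin n) {m : ℕ}
    (hm : m < N r) (hd : qRising q (d * x r) (N r) ≠ 0)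
    (ha : ∀ i : ℕ, 1 - a * x r * q ^ i ≠ 0) :
    qRising q (d / (q ^ m * x r)⁻¹) (multiSum N) /
        qRising q (a * q / (q ^ m * x r)⁻¹) (multiSum N) * wellPoisedProd q a d x N =
      qRising q (d / (q ^ N r * x r)⁻¹) (multiSum (Function.update N r m)) /
        qRising q (a * q / (q ^ N r * x r)⁻¹) (multiSum (Function.update N r m)) *
        wellPoisedProd q a d x (Function.update N r m) := by
  simp only [wellPoisedProd]
  rw [← Finset.mul_prod_erase _ _ (Finset.mem_univ r),
      ← Finset.mul_prod_erase _ (fun s => qRising q (a * q * x s) (Function.update N r m s) /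
        qRising q (d * x s) (Function.update N r m s)) (Finset.mem_univ r)]
  have : ∏ s ∈ Finset.univ.erase r, qRising q (a * q * x s) (Function.update N r m s) /
        qRising q (d * x s) (Function.update N r m s) =
      ∏ s ∈ Finset.univ.erase r, qRising q (a * q * x s) (N s) / qRising q (d * x s) (N s) :=
    Finset.prod_congr rfl fun s hs => by
      rw [Function.update_of_ne (Finset.ne_of_mem_erase hs)]
  rw [this, Function.update_self, ← mul_assoc, ← mul_assoc]
  congr 1
  have e : ∀ (u : ℂ) (t : ℕ), u / (q ^ t * x r)⁻¹ = u * x r * q ^ t := fun u t => by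
    rw [div_inv_eq_mul]; ring
  simp only [e]
  have h1 := qRising_split_comm q (d * x r) (multiSum_update N r m)
  have h2 := qRising_split_comm q (a * q * x r) (multiSum_update N r m)
  have hA : ∀ (t M : ℕ), qRising q (a * q * x r * q ^ t) M ≠ 0 := fun t M =>
    qRising_ne_zero_iff.2 fun i _ => by
      have := ha (1 + t + i)
      rwa [pow_add, pow_add, pow_one, show a * x r * (q * q ^ t * q ^ i) =
        a * q * x r * q ^ t * q ^ i by ring] at this
  have := qRising_ne_zero_of_le hd hm.le
  have := hA m (multiSum N)
  have := hA (N r) (multiSum (Function.update N r m))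
  rw [div_mul_div_comm, div_mul_div_comm, div_eq_div_iff (by positivity) (by positivity)]
  linear_combination (qRising q (a * q * x r) (N r) * qRising q (a * q * x r * q ^ N r)
      (multiSum (Function.update N r m))) * h1 -
    (qRising q (d * x r) (N r) * qRising q (d * x r * q ^ N r)
      (multiSum (Function.update N r m))) * h2

/-- The numbers `x_r q^m` with `m ≤ N_r` are distinct when the denominators do not vanish. -/
lemma pow_mul_injective (hq : q ≠ 0) (hx : ∀ r, x r ≠ 0)
    (hV : ∀ r s, r < s → 1 - x r / x s ≠ 0) {N : Fin n → ℕ}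
    (hqx : ∀ r s, qRising q (q * (x r / x s)) (N r) ≠ 0) {r s : Fin n} {m m' : ℕ}
    (hm : m ≤ N r) (hm' : m' ≤ N s) (h : q ^ m * x r = q ^ m' * x s) : r = s ∧ m = m' := by
  wlog hmm : m ≤ m' generalizing r s m m'
  · obtain ⟨h1, h2⟩ := this hm' hm h.symm (le_of_not_ge hmm)
    exact ⟨h1.symm, h2.symm⟩
  obtain ⟨t, rfl⟩ := Nat.exists_eq_add_of_le hmm
  have h1 : x r = q ^ t * x s := by
    apply mul_left_cancel₀ (pow_ne_zero m hq); rw [h, pow_add, mul_assoc]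
  rcases t with _ | t
  · refine ⟨?_, rfl⟩
    rw [pow_zero, one_mul] at h1
    rcases lt_trichotomy r s with h2 | h2 | h2
    · exact absurd (by rw [h1, div_self (hx s), sub_self]) (hV r s h2)
    · exact h2
    · exact absurd (by rw [h1, div_self (hx s), sub_self]) (hV s r h2)
  · refine absurd ?_ (qRising_ne_zero_iff.1 (hqx s r) t (by omega))
    rw [h1]
    have := hx s
    have := pow_ne_zero t hq
    field_simp
    ring

/-- The coefficient with `q^(-N_s) / x_s` substituted into the factors of the `n` parameters: the
powers of `x_s` cancel. -/
lemma wellPoisedCoeff_eq (hx : ∀ r, x r ≠ 0) (N k : Fin n → ℕ) :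
    wellPoisedCoeff q a b d x N k = vandermondeA q x k *
      (∏ r, ∏ s, qRising q (q ^ (-(N s : ℤ)) * (x r / x s)) (k r) /
        qRising q (q * (x r / x s)) (k r)) *
      (∏ r, ((1 - a * x r * q ^ (k r + multiSum k)) * qRising q (a * x r) (multiSum k)) /
        ((1 - a * x r) * qRising q (a * x r * q ^ (1 + N r)) (multiSum k) *
          qRising q (d * x r) (k r))) *
      qRising q b (multiSum k) * (d * q ^ multiSum N) ^ multiSum k *
      q ^ (∑ r : Fin n, (r : ℕ) * k r) := by
  have hF : ∏ s, nodeFactor q a x k ((q ^ N s * x s)⁻¹) =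
      (∏ r, ∏ s, qRising q (q ^ (-(N s : ℤ)) * (x r / x s)) (k r)) *
      (q ^ multiSum N) ^ multiSum k * (∏ s, x s ^ multiSum k) *
      ∏ r, (qRising q (a * x r * q ^ (1 + N r)) (multiSum k))⁻¹ := by
    rw [Finset.prod_comm]
    conv_rhs => rw [multiSum, ← Finset.prod_pow_eq_pow_sum, ← Finset.prod_pow]
    rw [← Finset.prod_mul_distrib, ← Finset.prod_mul_distrib, ← Finset.prod_mul_distrib]
    refine Finset.prod_congr rfl fun s _ => ?_
    have e1 : ∀ r, (q ^ N s * x s)⁻¹ * x r = q ^ (-(N s : ℤ)) * (x r / x s) := fun r => by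
      rw [zpow_neg, zpow_natCast, mul_inv]; ring
    have e2 : a * q / (q ^ N s * x s)⁻¹ = a * x s * q ^ (1 + N s) := by
      rw [div_inv_eq_mul]; ring
    simp only [nodeFactor, e1, e2, multiSum]
    rw [inv_pow, mul_pow, div_eq_mul_inv, mul_inv, inv_inv]
    ring
  have hxx : (∏ s, (x s ^ multiSum k)⁻¹) * ∏ s, x s ^ multiSum k = 1 := by
    rw [← Finset.prod_mul_distrib]
    exact Finset.prod_eq_one fun s _ => inv_mul_cancel₀ (pow_ne_zero _ (hx s))
  rw [wellPoisedCoeff, wellPoisedWeight, hF]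
  simp only [Finset.prod_div_distrib, Finset.prod_mul_distrib, Finset.prod_inv_distrib, mul_pow]
    at hxx ⊢
  linear_combination (vandermondeA q x k * (∏ r, ∏ s, qRising q (q * (x r / x s)) (k r))⁻¹ *
    ((∏ r, (1 - a * x r * q ^ (k r + multiSum k))) * ∏ r, qRising q (a * x r) (multiSum k)) *
    ((∏ r, (1 - a * x r))⁻¹ * (∏ r, qRising q (d * x r) (k r))⁻¹) *
    qRising q b (multiSum k) * d ^ multiSum k * q ^ (∑ r : Fin n, (r : ℕ) * k r) *
    (∏ r, ∏ s, qRising q (q ^ (-(N s : ℤ)) * (x r / x s)) (k r)) *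
    (q ^ multiSum N) ^ multiSum k *
    (∏ r, qRising q (a * x r * q ^ (1 + N r)) (multiSum k))⁻¹) * hxx

/-- At `c = a q^|N|` only the summand `k = N` survives. -/
lemma wellPoisedPoly_eval_last (hq : q ≠ 0) (ha : a ≠ 0) (hx : ∀ r, x r ≠ 0)
    (hV : ∀ r s, r < s → 1 - x r / x s ≠ 0) (hbd : b * d = a * q) (N : Fin n → ℕ)
    (hqx : ∀ r s, qRising q (q * (x r / x s)) (N r) ≠ 0)
    (hd : ∀ r, qRising q (d * x r) (N r) ≠ 0)
    (hgen : ∀ r (i : ℕ), 1 - a * x r * q ^ i ≠ 0) :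
    (wellPoisedPoly q a b d x N).eval (a * q ^ multiSum N) = 0 := by
  rw [wellPoisedPoly, Polynomial.eval_sub, Polynomial.eval_finsetSum,
    Finset.sum_eq_single_of_mem N (Finset.mem_Iic.2 le_rfl), sub_eq_zero]
  · simp only [Polynomial.eval_mul, Polynomial.eval_C, Polynomial.eval_prod, Polynomial.eval_sub,
      Polynomial.eval_X, Polynomial.eval_one, Finset.Ico_self, Finset.prod_empty, mul_one]
    have h2 : ∀ r, ∏ i ∈ Finset.range (N r), (1 - x r * q ^ i * (a * q ^ multiSum N)) =
        qRising q (a * x r * q ^ multiSum N) (N r) :=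
      fun r => Finset.prod_congr rfl fun i _ => by ring
    have hR : (∏ r, ((1 - a * x r * q ^ (N r + multiSum N)) * qRising q (a * x r) (multiSum N)) /
        ((1 - a * x r) * qRising q (a * x r * q ^ (1 + N r)) (multiSum N) *
          qRising q (d * x r) (N r))) * ∏ r, qRising q (a * x r * q ^ multiSum N) (N r) =
        wellPoisedProd q a d x N := by
      rw [← Finset.prod_mul_distrib]
      refine Finset.prod_congr rfl fun r _ => ?_
      have h1 : (1 - a * x r * q ^ (N r + multiSum N)) * (qRising q (a * x r) (multiSum N) *
          qRising q (a * x r * q ^ multiSum N) (N r)) = (1 - a * x r) *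
          (qRising q (a * q * x r) (N r) * qRising q (a * x r * q ^ (1 + N r)) (multiSum N)) := by
        rw [← qRising_add, show a * x r * q ^ (1 + N r) = a * q * x r * q ^ N r by ring,
          ← qRising_add, show a * q * x r = a * x r * q by ring, ← qRising_succ_left,
          qRising_succ, add_comm (N r)]
        ring
      have h3 : 1 - a * x r ≠ 0 := by simpa using hgen r 0
      have h4 : qRising q (a * x r * q ^ (1 + N r)) (multiSum N) ≠ 0 :=
        qRising_ne_zero_iff.2 fun i _ => by
          have := hgen r (1 + N r + i)
          rwa [pow_add, ← mul_assoc] at this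
      rw [div_mul_eq_mul_div, div_eq_iff (mul_ne_zero (mul_ne_zero h3 h4) (hd r)),
        div_mul_eq_mul_div, eq_div_iff (hd r)]
      linear_combination (qRising q (d * x r) (N r)) * h1
    have hM := vandermondeA_mul_prod hq hx hV N 0
    simp only [Pi.zero_apply, add_zero, qRising_zero, mul_one] at hM
    rw [show multiSum (0 : Fin n → ℕ) = 0 by simp [multiSum], zero_mul, zero_add] at hM
    have hc : (-1) ^ multiSum N * qRising q b (multiSum N) * (d * q ^ multiSum N) ^ multiSum N =
        (∏ i ∈ Finset.range (multiSum N), (a * q ^ multiSum N - d * q ^ i)) *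
          q ^ (multiSum N + 1).choose 2 := by
      have hp := fun t : ℕ => pow_ne_zero t hq
      have hb : b ≠ 0 := by
        rintro rfl; rw [zero_mul] at hbd; exact mul_ne_zero ha hq hbd.symm
      have h1 := qRising_reverse (q := q) (u := b) (w := d / (a * q ^ multiSum N))
        (j := multiSum N) hq (by have := hp (multiSum N); field_simp; linear_combination hbd)
      have h3 : ∏ i ∈ Finset.range (multiSum N), (a * q ^ multiSum N - d * q ^ i) =
          (a * q ^ multiSum N) ^ multiSum N *
            qRising q (d / (a * q ^ multiSum N)) (multiSum N) := by
        rw [qRising]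
        conv_rhs => rw [← Finset.card_range (multiSum N), ← Finset.prod_const, Finset.card_range,
          ← Finset.prod_mul_distrib]
        refine Finset.prod_congr rfl fun i _ => ?_
        have := hp (multiSum N)
        field_simp
      have h4 : (-1 : ℂ) ^ multiSum N * (-b) ^ multiSum N * d ^ multiSum N =
          a ^ multiSum N * q ^ multiSum N := by
        rw [← mul_pow, ← mul_pow, ← mul_pow]; congr 1; linear_combination hbd
      rw [h3, h1, Nat.choose_succ_succ' _ 1, Nat.choose_one_right, mul_pow, mul_pow, pow_add]
      linear_combination (q ^ (multiSum N).choose 2 *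
        qRising q (d / (a * q ^ multiSum N)) (multiSum N) *
          (q ^ multiSum N) ^ multiSum N) * h4
    simp only [h2]
    have hX : ∏ r, ∏ s, qRising q (q * (x r / x s)) (N r) ≠ 0 :=
      Finset.prod_ne_zero_iff.2 fun r _ => Finset.prod_ne_zero_iff.2 fun s _ => hqx r s
    have hYX : vandermondeA q x N * (∏ r, ∏ s, qRising q (q ^ (-(N s : ℤ)) * (x r / x s)) (N r) /
        qRising q (q * (x r / x s)) (N r)) * q ^ (∑ r : Fin n, (r : ℕ) * N r) *
        q ^ (multiSum N + 1).choose 2 = (-1) ^ multiSum N := by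
      simp only [Finset.prod_div_distrib]
      rw [mul_div_assoc', div_mul_eq_mul_div, div_mul_eq_mul_div, div_eq_iff hX, ← hM, pow_add]
      ring
    rw [wellPoisedCoeff_eq hx, ← hR]
    apply mul_right_cancel₀ (pow_ne_zero ((multiSum N + 1).choose 2) hq)
    generalize (∏ r, ((1 - a * x r * q ^ (N r + multiSum N)) * _) / _ : ℂ) = R at *
    generalize (∏ r, qRising q (a * x r * q ^ multiSum N) (N r)) = T at *
    linear_combination (R * T * qRising q b (multiSum N) * (d * q ^ multiSum N) ^ multiSum N) *
      hYX + R * T * hc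
  · intro k hk hkN
    have hlt : multiSum k < multiSum N := by
      have hk := Finset.mem_Iic.1 hk
      obtain ⟨r, hr⟩ := Function.ne_iff.1 hkN
      exact Finset.sum_lt_sum (fun i _ => hk i) ⟨r, Finset.mem_univ r, lt_of_le_of_ne (hk r) hr⟩
    -- the factor `c - a q^|N|` occurs as soon as `|k| < |N|`
    obtain ⟨M, hM⟩ : ∃ M, multiSum N = M + 1 := ⟨multiSum N - 1, by omega⟩
    simp only [Polynomial.eval_mul, Polynomial.eval_prod, Polynomial.eval_sub,
      Polynomial.eval_X, Polynomial.eval_C]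
    rw [Finset.prod_eq_zero (i := M) (s := Finset.Ico _ _) (Finset.mem_Ico.2 (by omega)), mul_zero,
      mul_zero]
    rw [hM]; ring

/-- Terminating `₆φ₅` sum over `A_n`, for `a` in general position. -/
theorem sum_wellPoised (hq : q ≠ 0) (ha : a ≠ 0) (hx : ∀ r, x r ≠ 0)
    (hV : ∀ r s, r < s → 1 - x r / x s ≠ 0) (hbd : b * d = a * q)
    (hgen : ∀ r (i : ℕ), 1 - a * x r * q ^ i ≠ 0) (N : Fin n → ℕ)
    (hqx : ∀ r s, qRising q (q * (x r / x s)) (N r) ≠ 0)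
    (hd : ∀ r, qRising q (d * x r) (N r) ≠ 0) {c : ℂ} (hc : c ≠ 0)
    (he : qRising q (a * q / c) (multiSum N) ≠ 0) :
    ∑ k ∈ Finset.Iic N, wellPoisedCoeff q a b d x N k * nodeFactor q a x k c =
      qRising q (d / c) (multiSum N) / qRising q (a * q / c) (multiSum N) *
        wellPoisedProd q a d x N := by
  induction hM : multiSum N using Nat.strong_induction_on generalizing N c with
  | _ M ih =>
  subst hM
  have hnode : ∀ (r : Fin n) (m M : ℕ), qRising q (a * q / (q ^ m * x r)⁻¹) M ≠ 0 := fun r m M =>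
    qRising_ne_zero_iff.2 fun i _ => by
      have := hgen r (1 + m + i)
      rw [div_inv_eq_mul]
      rwa [pow_add, pow_add, pow_one, show a * x r * (q * q ^ m * q ^ i) =
        a * q * (q ^ m * x r) * q ^ i by ring] at this
  have hnz : ∀ (r : Fin n) (m : ℕ), (q ^ m * x r)⁻¹ ≠ 0 := fun r m =>
    inv_ne_zero (mul_ne_zero (pow_ne_zero _ hq) (hx r))
  have hP : wellPoisedPoly q a b d x N = 0 := by
    -- the `|N| + 1` points of comparison
    let v : Option (Σ r, Fin (N r)) → ℂ := fun o =>
      o.elim (a * q ^ multiSum N) fun p => (q ^ (p.2 : ℕ) * x p.1)⁻¹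
    have hv : Function.Injective v := by
      have key' : ∀ p : Σ r, Fin (N r), a * q ^ multiSum N ≠ (q ^ (p.2 : ℕ) * x p.1)⁻¹ := by
        intro p h
        refine hgen p.1 (multiSum N + p.2) ?_
        rw [pow_add, show a * x p.1 * (q ^ multiSum N * q ^ (p.2 : ℕ)) =
          (a * q ^ multiSum N) * (q ^ (p.2 : ℕ) * x p.1) by ring, h,
          inv_mul_cancel₀ (mul_ne_zero (pow_ne_zero _ hq) (hx _)), sub_self]
      rintro (_ | ⟨r, m⟩) (_ | ⟨s, m'⟩) h
      · rfl
      · exact absurd h (key' _)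
      · exact absurd h.symm (key' _)
      · have h : q ^ (m : ℕ) * x r = q ^ (m' : ℕ) * x s := inv_injective h
        obtain ⟨rfl, h2⟩ := pow_mul_injective hq hx hV hqx m.2.le m'.2.le h
        rw [Fin.ext h2]
    refine Polynomial.eq_zero_of_degree_lt_of_eval_index_eq_zero
      (s := Finset.univ) (v := v) hv.injOn ?_ ?_
    · refine (wellPoisedPoly_degree N).trans_lt ?_
      rw [Finset.card_univ, Fintype.card_option, Fintype.card_sigma]
      simp only [Fintype.card_fin]
      exact_mod_cast Nat.lt_succ_self _
    · rintro (_ | ⟨r, m⟩) -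
      · exact wellPoisedPoly_eval_last hq ha hx hV hbd N hqx hd hgen
      · change Polynomial.eval (q ^ (m : ℕ) * x r)⁻¹ _ = 0
        rw [wellPoisedPoly_eval N (hnz r m) (hnode r m _), sum_at_node hq hx N r m.2,
          prod_at_node N r m.2 (hd r) (hgen r)]
        have hle : ∀ s, Function.update N r m s ≤ N s := by
          intro s; rcases eq_or_ne s r with rfl | h
          · simp
          · simp [h]
        rw [ih _ (by have := multiSum_update N r m; have := m.2; omega) _
          (fun r s => qRising_ne_zero_of_le (hqx r s) (hle r))
          (fun r => qRising_ne_zero_of_le (hd r) (hle r)) (hnz r _) (hnode r _ _) rfl,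
          sub_self, mul_zero]
  have h := wellPoisedPoly_eval (b := b) (d := d) (x := x) N hc he
  rw [hP, Polynomial.eval_zero, zero_eq_mul, or_iff_right
    (mul_ne_zero (pow_ne_zero _ hc) he)] at h
  exact sub_eq_zero.1 h

end SixPhiFive

/-! ### Shifting the summation index -/

section Shift

variable {n : ℕ} {q a b c d : ℂ} {x : Fin n → ℂ}

lemma one_sub_shift_ne_zero (hq : q ≠ 0) (hx : ∀ r, x r ≠ 0)
    (hV : ∀ r s, r < s → 1 - x r / x s ≠ 0) {N : Fin n → ℕ}
    (hqx : ∀ r s, qRising q (q * (x r / x s)) (N r) ≠ 0) {j : Fin n → ℕ} (hj : j ≤ N)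
    (r s : Fin n) (hrs : r < s) : 1 - x r * q ^ j r / (x s * q ^ j s) ≠ 0 := by
  intro h
  have h1 : x s * q ^ j s ≠ 0 := mul_ne_zero (hx s) (pow_ne_zero _ hq)
  rw [one_sub_div h1, div_eq_zero_iff, or_iff_left h1] at h
  exact hrs.ne (pow_mul_injective hq hx hV hqx (hj r) (hj s) (by linear_combination -h)).1

lemma qRising_shift_ne_zero (hq : q ≠ 0) (hx : ∀ r, x r ≠ 0)
    (hV : ∀ r s, r < s → 1 - x r / x s ≠ 0) {N : Fin n → ℕ}
    (hqx : ∀ r s, qRising q (q * (x r / x s)) (N r) ≠ 0) {j : Fin n → ℕ} (hj : j ≤ N)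
    (r s : Fin n) :
    qRising q (q * (x r * q ^ j r / (x s * q ^ j s))) ((N - j) r) ≠ 0 := by
  refine qRising_ne_zero_iff.2 fun i hi h => ?_
  have h1 : x s * q ^ j s ≠ 0 := mul_ne_zero (hx s) (pow_ne_zero _ hq)
  rw [mul_div_assoc', div_mul_eq_mul_div, one_sub_div h1, div_eq_zero_iff, or_iff_left h1] at h
  have hi : i < N r - j r := hi
  obtain ⟨rfl, h2⟩ := pow_mul_injective hq hx hV hqx (r := r) (s := s)
    (m := 1 + i + j r) (by omega) (hj s)
    (by rw [pow_add, pow_add]; linear_combination -h)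
  omega

lemma vandermondeA_add (hq : q ≠ 0) (hx : ∀ r, x r ≠ 0) (j l : Fin n → ℕ)
    (hV : ∀ r s, r < s → 1 - x r * q ^ j r / (x s * q ^ j s) ≠ 0) :
    vandermondeA q x (j + l) =
      vandermondeA q x j * vandermondeA q (fun r => x r * q ^ j r) l := by
  simp only [vandermondeA, ← Finset.prod_mul_distrib]
  refine Finset.prod_congr rfl fun r _ => Finset.prod_congr rfl fun s hs => ?_
  have h1 := hV r s (Finset.mem_Ioi.1 hs)
  have hp := fun t : ℕ => pow_ne_zero t hq
  have e1 : q ^ ((j r : ℤ) - j s) * (x r / x s) = x r * q ^ j r / (x s * q ^ j s) := by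
    rw [zpow_sub₀ hq, zpow_natCast, zpow_natCast]
    have := hp (j s); have := hx s
    field_simp
  have e2 : q ^ (((j + l) r : ℕ) - ((j + l) s : ℕ) : ℤ) * (x r / x s) =
      q ^ ((l r : ℤ) - l s) * (x r * q ^ j r / (x s * q ^ j s)) := by
    rw [← e1, ← mul_assoc, ← zpow_add₀ hq]
    congr 2
    simp only [Pi.add_apply]; push_cast; ring
  rw [e1, e2, div_mul_div_comm, mul_comm (1 - x r / x s), mul_div_mul_left _ _ h1]

lemma prod_qRising_neg_add (hq : q ≠ 0) {N j : Fin n → ℕ} (hj : j ≤ N) (l : Fin n → ℕ) :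
    ∏ r, ∏ s, qRising q (q ^ (-(N s : ℤ)) * (x r / x s)) ((j + l) r) =
      (∏ r, ∏ s, qRising q (q ^ (-(N s : ℤ)) * (x r / x s)) (j r)) *
      ∏ r, ∏ s, qRising q (q ^ (-((N - j) s : ℕ) : ℤ) *
        (x r * q ^ j r / (x s * q ^ j s))) (l r) := by
  simp only [← Finset.prod_mul_distrib]
  refine Finset.prod_congr rfl fun r _ => Finset.prod_congr rfl fun s _ => ?_
  rw [Pi.add_apply, qRising_add]
  congr 2
  rw [Pi.sub_apply, Nat.cast_sub (hj s), neg_sub, zpow_sub₀ hq, zpow_neg, zpow_natCast,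
    zpow_natCast]
  have := pow_ne_zero (j s) hq
  field_simp

lemma vandermondeA_mul_prod_shift (hq : q ≠ 0) (hx : ∀ r, x r ≠ 0)
    (hV : ∀ r s, r < s → 1 - x r / x s ≠ 0) (j l : Fin n → ℕ) :
    vandermondeA q x j *
      (∏ r, ∏ s, qRising q (q ^ (-((j + l) s : ℕ) : ℤ) * (x r / x s)) (j r)) *
      (∏ r, ∏ s, qRising q (q * (x r * q ^ j r / (x s * q ^ j s))) (l r)) *
      (q ^ (multiSum l * multiSum j) * q ^ (multiSum j + 1).choose 2 *
        q ^ (∑ r : Fin n, (r : ℕ) * j r)) =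
    (-1) ^ multiSum j * ∏ r, ∏ s, qRising q (q * (x r / x s)) ((j + l) r) := by
  have e : ∀ r s, q * (x r * q ^ j r / (x s * q ^ j s)) =
      q * q ^ ((j r : ℤ) - j s) * (x r / x s) := fun r s => by
    rw [zpow_sub₀ hq, zpow_natCast, zpow_natCast]
    have := pow_ne_zero (j s) hq; have := hx s
    field_simp
  simp only [Pi.add_apply, e]
  rw [← vandermondeA_mul_prod hq hx hV]
  simp only [Finset.prod_mul_distrib, pow_add]
  ring

lemma nodeFactor_add (j l : Fin n → ℕ) :
    nodeFactor q a x (j + l) c =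
      nodeFactor q a x j c *
        nodeFactor q (a * q ^ multiSum j) (fun r => x r * q ^ j r) l c := by
  simp only [nodeFactor, multiSum_add, Pi.add_apply, qRising_add, pow_add,
    Finset.prod_mul_distrib]
  rw [div_mul_div_comm, show a * q / c * q ^ multiSum j = a * q ^ multiSum j * q / c by ring]
  simp only [mul_assoc, mul_comm, mul_left_comm]

/-- The quotient of the very-well-poised part of a summand at `j + l`, times
`∏ (a x_r q^|j+l|)_(j_r)`, and that of the shifted summand at `l`: it does not depend on `l`. -/
noncomputable def shiftFactor (q a d : ℂ) (x : Fin n → ℂ) (N j : Fin n → ℕ) : ℂ :=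
  ∏ r, ((1 - a * x r * q ^ (j r + multiSum j)) * qRising q (a * x r) (multiSum j + j r)) /
    ((1 - a * x r) * qRising q (a * x r * q ^ (1 + N r)) (multiSum j) * qRising q (d * x r) (j r))

lemma wellPoised_prod_add (hgen : ∀ r (i : ℕ), 1 - a * x r * q ^ i ≠ 0) {N j : Fin n → ℕ}
    (hj : j ≤ N) (l : Fin n → ℕ) :
    (∏ r, ((1 - a * x r * q ^ ((j + l) r + multiSum (j + l))) *
        qRising q (a * x r) (multiSum (j + l))) /
      ((1 - a * x r) * qRising q (a * x r * q ^ (1 + N r)) (multiSum (j + l)) *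
        qRising q (d * x r) ((j + l) r))) *
      ∏ r, qRising q (a * x r * q ^ multiSum (j + l)) (j r) =
    shiftFactor q a d x N j *
      ∏ r, ((1 - a * q ^ multiSum j * (x r * q ^ j r) * q ^ (l r + multiSum l)) *
        qRising q (a * q ^ multiSum j * (x r * q ^ j r)) (multiSum l)) /
      ((1 - a * q ^ multiSum j * (x r * q ^ j r)) *
        qRising q (a * q ^ multiSum j * (x r * q ^ j r) * q ^ (1 + (N - j) r)) (multiSum l) *
        qRising q (d * (x r * q ^ j r)) (l r)) := by
  rw [shiftFactor, ← Finset.prod_mul_distrib, ← Finset.prod_mul_distrib]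
  refine Finset.prod_congr rfl fun r _ => ?_
  have h1 := hgen r (j r + multiSum j)
  have e1 : a * q ^ multiSum j * (x r * q ^ j r) = a * x r * q ^ (j r + multiSum j) := by
    rw [pow_add]; ring
  have e2 : a * x r * q ^ (j r + multiSum j) * q ^ (1 + (N - j) r) =
      a * x r * q ^ (1 + N r) * q ^ multiSum j := by
    rw [mul_assoc, mul_assoc _ (q ^ (1 + N r)), ← pow_add, ← pow_add]
    congr 2
    have : j r ≤ N r := hj r
    simp only [Pi.sub_apply]; omega
  have e3 := qRising_split_comm q (a * x r) (m := multiSum j + multiSum l) (T := j r)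
    (n := multiSum j + j r) (S := multiSum l) (by ring)
  have e4 : a * x r * q ^ (j r + multiSum j) * q ^ (l r + multiSum l) =
      a * x r * q ^ (j r + l r + (multiSum j + multiSum l)) := by
    simp only [pow_add]; ring
  rw [add_comm (multiSum j) (j r)] at e3
  rw [e1, e2, e4, multiSum_add, Pi.add_apply, qRising_add q (a * x r * q ^ (1 + N r)),
    qRising_add q (d * x r), mul_assoc d, div_mul_eq_mul_div, mul_assoc (1 - _), e3,
    add_comm (multiSum j) (j r)]
  generalize 1 - a * x r * q ^ (j r + l r + (multiSum j + multiSum l)) = W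
  generalize 1 - a * x r * q ^ (j r + multiSum j) = A at *
  rw [div_mul_div_comm, show ∀ X Y P S T : ℂ, A * X * (W * Y) / (P * (A * S * T)) =
    A * (W * (X * Y)) / (A * (P * (S * T))) by intros; ring_nf, mul_div_mul_left _ _ h1]
  ring

lemma prod_prod_div (f g : Fin n → Fin n → ℂ) :
    ∏ r, ∏ s, f r s / g r s = (∏ r, ∏ s, f r s) / ∏ r, ∏ s, g r s := by
  simp only [Finset.prod_div_distrib]

/-- The summand at `j + l`, times the coefficient with which `α j` enters, is a constant multiple
of the summand at `l` for the parameters `a q^|j|`, `b q^|j|`, `x_r q^(j_r)` and `N - j`. -/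
lemma summand_shift (hq : q ≠ 0) (hx : ∀ r, x r ≠ 0)
    (hV : ∀ r s, r < s → 1 - x r / x s ≠ 0) (hgen : ∀ r (i : ℕ), 1 - a * x r * q ^ i ≠ 0)
    {N : Fin n → ℕ} (hqx : ∀ r s, qRising q (q * (x r / x s)) (N r) ≠ 0) {j l : Fin n → ℕ}
    (hjl : j + l ≤ N) :
    wellPoisedCoeff q a b d x N (j + l) * nodeFactor q a x (j + l) c *
      (vandermondeA q x j *
        (∏ r, ∏ s, qRising q (q ^ (-((j + l) s : ℕ) : ℤ) * (x r / x s)) (j r)) *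
        ∏ r, qRising q (a * x r * q ^ multiSum (j + l)) (j r)) =
    vandermondeA q x j * (∏ r, ∏ s, qRising q (q ^ (-(N s : ℤ)) * (x r / x s)) (j r)) *
      shiftFactor q a d x N j * qRising q b (multiSum j) * (d * q ^ multiSum N) ^ multiSum j *
      nodeFactor q a x j c * ((-1) ^ multiSum j / q ^ (multiSum j + 1).choose 2) *
      (wellPoisedCoeff q (a * q ^ multiSum j) (b * q ^ multiSum j) d (fun r => x r * q ^ j r)
        (N - j) l * nodeFactor q (a * q ^ multiSum j) (fun r => x r * q ^ j r) l c) := by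
  have hj : j ≤ N := le_self_add.trans hjl
  have hx' : ∀ r, x r * q ^ j r ≠ 0 := fun r => mul_ne_zero (hx r) (pow_ne_zero _ hq)
  have hM := vandermondeA_mul_prod_shift hq hx hV j l
  have hR := wellPoised_prod_add (d := d) hgen hj l
  have hX : ∏ r, ∏ s, qRising q (q * (x r / x s)) ((j + l) r) ≠ 0 :=
    Finset.prod_ne_zero_iff.2 fun r _ => Finset.prod_ne_zero_iff.2 fun s _ =>
      qRising_ne_zero_of_le (hqx r s) (hjl r)
  have hX' : ∏ r, ∏ s, qRising q (q * (x r * q ^ j r / (x s * q ^ j s))) (l r) ≠ 0 :=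
    Finset.prod_ne_zero_iff.2 fun r _ => Finset.prod_ne_zero_iff.2 fun s _ =>
      qRising_ne_zero_of_le (qRising_shift_ne_zero hq hx hV hqx hj r s)
        (le_tsub_of_add_le_left (hjl r))
  have hC := pow_ne_zero ((multiSum j + 1).choose 2) hq
  have hS : q ^ (∑ r : Fin n, (r : ℕ) * (j + l) r) =
      q ^ (∑ r : Fin n, (r : ℕ) * j r) * q ^ (∑ r : Fin n, (r : ℕ) * l r) := by
    rw [← pow_add, ← Finset.sum_add_distrib]
    simp only [Pi.add_apply, mul_add]
  have hNj : multiSum (N - j) + multiSum j = multiSum N := by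
    rw [← multiSum_add, show N - j + j = N from funext fun r => Nat.sub_add_cancel (hj r)]
  have hN : (d * q ^ multiSum N) ^ multiSum (j + l) = (d * q ^ multiSum N) ^ multiSum j *
      ((d * q ^ multiSum (N - j)) ^ multiSum l * q ^ (multiSum l * multiSum j)) := by
    rw [multiSum_add, pow_add, mul_comm (multiSum l), pow_mul, ← mul_pow, mul_assoc d, ← pow_add q,
      hNj]
  rw [wellPoisedCoeff_eq hx, wellPoisedCoeff_eq hx',
    vandermondeA_add hq hx j l (one_sub_shift_ne_zero hq hx hV hqx hj), nodeFactor_add,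
    hS, hN]
  rw [prod_prod_div, prod_prod_div, prod_qRising_neg_add hq hj l, multiSum_add j l,
    qRising_add q b] at *
  generalize (∏ r : Fin n, _ / _ : ℂ) = R at *
  generalize (∏ r : Fin n, _ / _ : ℂ) = R' at *
  generalize (∏ r, ∏ s, qRising q (q * (x r / x s)) ((j + l) r)) = X at *
  generalize (∏ r, ∏ s, qRising q (q * (x r * q ^ j r / (x s * q ^ j s))) (l r)) = X' at *
  generalize (∏ r, ∏ s, qRising q (q ^ (-((j + l) s : ℕ) : ℤ) * (x r / x s)) (j r)) = Y at *
  generalize (∏ r, ∏ s, qRising q (q ^ (-(N s : ℤ)) * (x r / x s)) (j r)) = Y₁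
  generalize (∏ r, ∏ s, qRising q (q ^ (-((N - j) s : ℕ) : ℤ) *
    (x r * q ^ j r / (x s * q ^ j s))) (l r)) = Y₂
  generalize (∏ r, qRising q (a * x r * q ^ (multiSum j + multiSum l)) (j r)) = T at *
  generalize vandermondeA q (fun r => x r * q ^ j r) l = V'
  generalize nodeFactor q (a * q ^ multiSum j) (fun r => x r * q ^ j r) l c = F'
  have hM' : vandermondeA q x j * Y * q ^ (multiSum l * multiSum j) *
      q ^ (∑ r : Fin n, (r : ℕ) * j r) / X =
      (-1) ^ multiSum j / q ^ (multiSum j + 1).choose 2 / X' := by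
    rw [div_div, div_eq_div_iff hX (mul_ne_zero hC hX')]
    linear_combination hM
  linear_combination (vandermondeA q x j * V' * Y₁ * Y₂ * qRising q b (multiSum j) *
    qRising q (b * q ^ multiSum j) (multiSum l) * (d * q ^ multiSum N) ^ multiSum j *
    (d * q ^ multiSum (N - j)) ^ multiSum l * q ^ (∑ r : Fin n, (r : ℕ) * l r) *
    nodeFactor q a x j c * F') *
    (R * T * hM' + ((-1) ^ multiSum j / q ^ (multiSum j + 1).choose 2 / X') * hR)

lemma shiftFactor_mul_wellPoisedProd (hgen : ∀ r (i : ℕ), 1 - a * x r * q ^ i ≠ 0)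
    {N j : Fin n → ℕ} (hj : j ≤ N) (hd : ∀ r, qRising q (d * x r) (N r) ≠ 0) :
    shiftFactor q a d x N j *
      wellPoisedProd q (a * q ^ multiSum j) d (fun r => x r * q ^ j r) (N - j) =
    wellPoisedProd q a d x N := by
  rw [shiftFactor, wellPoisedProd, wellPoisedProd, ← Finset.prod_mul_distrib]
  refine Finset.prod_congr rfl fun r _ => ?_
  obtain ⟨t, ht⟩ := Nat.exists_eq_add_of_le (hj r)
  have e0 : (N - j) r = t := by rw [Pi.sub_apply, ht, Nat.add_sub_cancel_left]
  have hd := hd r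
  have h3 : 1 - a * x r ≠ 0 := by simpa using hgen r 0
  have h4 : qRising q (a * x r * q ^ (1 + N r)) (multiSum j) ≠ 0 :=
    qRising_ne_zero_iff.2 fun i _ => by
      have := hgen r (1 + N r + i)
      rwa [pow_add, ← mul_assoc] at this
  have h1 : (1 - a * x r * q ^ (j r + multiSum j)) * qRising q (a * x r) (multiSum j + j r) *
      qRising q (a * q ^ multiSum j * q * (x r * q ^ j r)) t = (1 - a * x r) *
      (qRising q (a * q * x r) (N r) * qRising q (a * x r * q ^ (1 + N r)) (multiSum j)) := by
    rw [show a * x r * q ^ (1 + N r) = a * q * x r * q ^ N r by ring,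
      ← qRising_add, show a * q * x r = a * x r * q by ring, ← qRising_succ_left, ht,
      show j r + t + multiSum j + 1 = (multiSum j + j r + 1) + t by ring,
      qRising_add q (a * x r) (multiSum j + j r + 1) t, qRising_succ, add_comm (j r)]
    rw [show a * q ^ multiSum j * q * (x r * q ^ j r) = a * x r * q ^ (multiSum j + j r + 1) by
      ring]
    ring
  have h2 : qRising q (d * x r) (N r) =
      qRising q (d * x r) (j r) * qRising q (d * (x r * q ^ j r)) t := by
    rw [ht, qRising_add, mul_assoc d]
  rw [e0, div_mul_div_comm, div_eq_div_iff _ hd, h2, h1]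
  · ring
  · rw [mul_assoc, ← h2]
    exact mul_ne_zero (mul_ne_zero h3 h4) hd

/-- Summation over `k ≥ j` of the summands of the `₆φ₅` sum, each multiplied by the coefficient
with which `α j` enters; `w` is `q^(1-|N|) c / d`. -/
lemma sum_wellPoised_mul_coeff (hq : q ≠ 0) (ha : a ≠ 0) (hx : ∀ r, x r ≠ 0)
    (hV : ∀ r s, r < s → 1 - x r / x s ≠ 0) (hbd : b * d = a * q)
    (hgen : ∀ r (i : ℕ), 1 - a * x r * q ^ i ≠ 0) {N : Fin n → ℕ}
    (hqx : ∀ r s, qRising q (q * (x r / x s)) (N r) ≠ 0)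
    (hd : ∀ r, qRising q (d * x r) (N r) ≠ 0) (hc : c ≠ 0)
    (he : qRising q (a * q / c) (multiSum N) ≠ 0) {w : ℂ} (hw : d / c * w * q ^ multiSum N = q)
    (hwN : qRising q w (multiSum N) ≠ 0) {j : Fin n → ℕ} (hj : j ≤ N) :
    ∑ k ∈ Finset.Icc j N, wellPoisedCoeff q a b d x N k * nodeFactor q a x k c *
      (vandermondeA q x j *
        (∏ r, ∏ s, qRising q (q ^ (-(k s : ℤ)) * (x r / x s)) (j r)) *
        ∏ r, qRising q (a * x r * q ^ multiSum k) (j r)) =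
    qRising q (d / c) (multiSum N) / qRising q (a * q / c) (multiSum N) *
      wellPoisedProd q a d x N *
      (vandermondeA q x j * (∏ r, ∏ s, qRising q (q ^ (-(N s : ℤ)) * (x r / x s)) (j r)) *
        (∏ r, qRising q (c * x r) (j r)) *
        (qRising q b (multiSum j) / qRising q w (multiSum j))) := by
  have hIcc : Finset.Icc j N = (Finset.Iic (N - j)).image (j + ·) := by
    ext k
    simp only [Finset.mem_Icc, Finset.mem_image, Finset.mem_Iic]
    constructor
    · rintro ⟨h1, h2⟩
      exact ⟨k - j, fun r => Nat.sub_le_sub_right (h2 r) _,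
        funext fun r => Nat.add_sub_cancel' (h1 r)⟩
    · rintro ⟨l, hl, rfl⟩
      exact ⟨le_self_add, fun r => by
        have h1 : l r ≤ N r - j r := hl r
        have h2 : j r ≤ N r := hj r
        simp only [Pi.add_apply]; omega⟩
  have hNj : multiSum j + multiSum (N - j) = multiSum N := by
    rw [← multiSum_add, show j + (N - j) = N from funext fun r => Nat.add_sub_cancel' (hj r)]
  rw [hIcc, Finset.sum_image (fun _ _ _ _ h => add_left_cancel h)]
  have hterm : ∀ l ∈ Finset.Iic (N - j), j + l ≤ N := fun l hl r => by
    have h1 : l r ≤ N r - j r := Finset.mem_Iic.1 hl r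
    have h2 : j r ≤ N r := hj r
    simp only [Pi.add_apply]; omega
  have he' := he
  rw [← hNj, qRising_add, show a * q / c * q ^ multiSum j = a * q ^ multiSum j * q / c by ring]
    at he'
  rw [Finset.sum_congr rfl fun l hl => summand_shift hq hx hV hgen hqx (hterm l hl),
    ← Finset.mul_sum, sum_wellPoised hq (mul_ne_zero ha (pow_ne_zero _ hq))
      (fun r => mul_ne_zero (hx r) (pow_ne_zero _ hq)) (one_sub_shift_ne_zero hq hx hV hqx hj)
      (by linear_combination q ^ multiSum j * hbd)
      (fun r i => by
        have := hgen r (multiSum j + j r + i)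
        rwa [show a * x r * q ^ (multiSum j + j r + i) =
          a * q ^ multiSum j * (x r * q ^ j r) * q ^ i by ring] at this)
      (N - j) (qRising_shift_ne_zero hq hx hV hqx hj)
      (fun r => by
        have h2 : j r ≤ N r := hj r
        have := hd r
        rw [← Nat.add_sub_cancel' h2, qRising_add, mul_assoc d] at this
        exact right_ne_zero_of_mul this) hc (right_ne_zero_of_mul he'),
    ← shiftFactor_mul_wellPoisedProd hgen hj hd, ← hNj,
    qRising_add q (a * q / c), show a * q / c * q ^ multiSum j = a * q ^ multiSum j * q / c by ring]
  have hrev : qRising q (d / c) (multiSum j + multiSum (N - j)) * q ^ (multiSum j + 1).choose 2 =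
      qRising q (d / c) (multiSum (N - j)) * ((-1) ^ multiSum j * (d / c) ^ multiSum j *
        (q ^ (multiSum j + multiSum (N - j))) ^ multiSum j * qRising q w (multiSum j)) := by
    have h1 := qRising_reverse (q := q) (u := d / c * q ^ multiSum (N - j)) (w := w)
      (j := multiSum j) hq (by rw [← hNj, pow_add] at hw; linear_combination hw)
    have h2 := two_mul_choose_two (multiSum j)
    rw [add_comm (multiSum j) (multiSum (N - j)), qRising_add, h1, Nat.choose_succ_succ' _ 1,
      Nat.choose_one_right, pow_add q (multiSum (N - j)), mul_pow (q ^ multiSum (N - j)),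
      ← pow_mul q (multiSum j) (multiSum j), ← h2, neg_pow, mul_pow (d / c)]
    ring
  have hw' := qRising_ne_zero_of_le hwN (multiSum_mono hj)
  have hC := pow_ne_zero ((multiSum j + 1).choose 2) hq
  have key : (d * q ^ (multiSum j + multiSum (N - j))) ^ multiSum j *
      (c ^ multiSum j)⁻¹ * ((-1) ^ multiSum j / q ^ (multiSum j + 1).choose 2) *
      qRising q (d / c) (multiSum (N - j)) =
      qRising q (d / c) (multiSum j + multiSum (N - j)) / qRising q w (multiSum j) := by
    rw [eq_div_iff hw', mul_div_assoc', div_mul_eq_mul_div, div_mul_eq_mul_div,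
      div_eq_iff hC, hrev, div_pow, mul_pow d]
    ring
  rw [nodeFactor]
  linear_combination (vandermondeA q x j *
    (∏ r, ∏ s, qRising q (q ^ (-(N s : ℤ)) * (x r / x s)) (j r)) * shiftFactor q a d x N j *
    qRising q b (multiSum j) * (∏ r, qRising q (c * x r) (j r)) *
    (qRising q (a * q / c) (multiSum j))⁻¹ *
    (qRising q (a * q ^ multiSum j * q / c) (multiSum (N - j)))⁻¹ *
    wellPoisedProd q (a * q ^ multiSum j) d (fun r => x r * q ^ j r) (N - j)) * key

end Shift

/-! ### The transformation for `a` in general position -/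

section Transformation

variable {n : ℕ} {q a A B : ℂ} {x : Fin n → ℂ} {N : Fin n → ℕ}

/-- The left-hand side of the transformation, as a function of `a`. -/
noncomputable def transformLeft (q A B : ℂ) (x : Fin n → ℂ) (N : Fin n → ℕ)
    (α : (Fin n → ℕ) → ℂ) (a : ℂ) : ℂ :=
  (qRising q (a * A * B / q) (multiSum N) / qRising q (a * A) (multiSum N)) *
    (∏ r, qRising q (a * q * x r) (N r) / qRising q (a * B * x r) (N r)) *
    (∑ j ∈ Finset.Iic N,
      vandermondeA q x j *
      (∏ r, ∏ s, qRising q (q ^ (-(N s : ℤ)) * (x r / x s)) (j r)) *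
      (∏ r, qRising q (q * x r / A) (j r)) *
      (qRising q (q / B) (multiSum j) /
        qRising q (q ^ (2 - (multiSum N : ℤ)) / (a * A * B)) (multiSum j)) *
      q ^ (∑ r : Fin n, ((r : ℕ) + 1) * j r) * α j)

/-- The right-hand side of the transformation, as a function of `a`. -/
noncomputable def transformRight (q A B : ℂ) (x : Fin n → ℂ) (N : Fin n → ℕ)
    (α : (Fin n → ℕ) → ℂ) (a : ℂ) : ℂ :=
  ∑ k ∈ Finset.Iic N,
    vandermondeA q x k *
    (∏ r, ∏ s, qRising q (q ^ (-(N s : ℤ)) * (x r / x s)) (k r) /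
      qRising q (q * (x r / x s)) (k r)) *
    (∏ r, ((1 - a * x r * q ^ (k r + multiSum k)) * qRising q (a * x r) (multiSum k) *
        qRising q (q * x r / A) (k r)) /
      ((1 - a * x r) * qRising q (a * x r * q ^ (1 + N r)) (multiSum k) *
        qRising q (a * B * x r) (k r))) *
    (qRising q (q / B) (multiSum k) / qRising q (a * A) (multiSum k)) *
    (a * A * B * q ^ ((multiSum N : ℤ) - 1)) ^ multiSum k *
    q ^ (∑ r : Fin n, (r : ℕ) * k r) *
    (∑ j ∈ Finset.Iic k,
      vandermondeA q x j *
      (∏ r, ∏ s, qRising q (q ^ (-(k s : ℤ)) * (x r / x s)) (j r)) *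
      (∏ r, qRising q (a * x r * q ^ multiSum k) (j r)) *
      q ^ (∑ r : Fin n, ((r : ℕ) + 1) * j r) * α j)

/-- The summand over `k` of the transformation is that of the `₆φ₅` sum with `b = q / B`,
`c = q / A` and `d = a B`. -/
lemma wellPoisedCoeff_mul_nodeFactor (hq : q ≠ 0) (hA : A ≠ 0) (hx : ∀ r, x r ≠ 0)
    (k : Fin n → ℕ) :
    vandermondeA q x k *
      (∏ r, ∏ s, qRising q (q ^ (-(N s : ℤ)) * (x r / x s)) (k r) /
        qRising q (q * (x r / x s)) (k r)) *
      (∏ r, ((1 - a * x r * q ^ (k r + multiSum k)) * qRising q (a * x r) (multiSum k) *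
          qRising q (q * x r / A) (k r)) /
        ((1 - a * x r) * qRising q (a * x r * q ^ (1 + N r)) (multiSum k) *
          qRising q (a * B * x r) (k r))) *
      (qRising q (q / B) (multiSum k) / qRising q (a * A) (multiSum k)) *
      (a * A * B * q ^ ((multiSum N : ℤ) - 1)) ^ multiSum k *
      q ^ (∑ r : Fin n, (r : ℕ) * k r) =
    wellPoisedCoeff q a (q / B) (a * B) x N k * nodeFactor q a x k (q / A) := by
  have e1 : a * A * B * q ^ ((multiSum N : ℤ) - 1) = a * B * q ^ multiSum N * (q / A)⁻¹ := by
    rw [zpow_sub_one₀ hq, zpow_natCast]; field_simp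
  have e2 : a * q / (q / A) = a * A := by field_simp
  have e3 : ∀ r, q * x r / A = q / A * x r := fun r => by ring
  rw [wellPoisedCoeff_eq hx, nodeFactor, e1, e2, mul_pow _ (q / A)⁻¹, inv_pow]
  simp only [e3, Finset.prod_div_distrib, Finset.prod_mul_distrib]
  ring

lemma transform_of_generic (α : (Fin n → ℕ) → ℂ) (hq : q ≠ 0) (ha : a ≠ 0) (hA : A ≠ 0)
    (hB : B ≠ 0) (hx : ∀ r, x r ≠ 0)
    (hV : ∀ r s, r < s → 1 - x r / x s ≠ 0)
    (hqx : ∀ r s, qRising q (q * (x r / x s)) (N r) ≠ 0)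
    (haA : qRising q (a * A) (multiSum N) ≠ 0)
    (haB : ∀ r, qRising q (a * B * x r) (N r) ≠ 0)
    (haAB : qRising q (q ^ (2 - (multiSum N : ℤ)) / (a * A * B)) (multiSum N) ≠ 0)
    (hgen : ∀ r (i : ℕ), 1 - a * x r * q ^ i ≠ 0) :
    transformLeft q A B x N α a = transformRight q A B x N α a := by
  have hc : q / A ≠ 0 := div_ne_zero hq hA
  have e2 : a * q / (q / A) = a * A := by field_simp
  have e4 : a * B / (q / A) = a * A * B / q := by field_simp
  have e3 : ∀ r, q * x r / A = q / A * x r := fun r => by ring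
  have hw : a * B / (q / A) * (q ^ (2 - (multiSum N : ℤ)) / (a * A * B)) * q ^ multiSum N = q := by
    have := pow_ne_zero (multiSum N) hq
    rw [zpow_sub₀ hq, zpow_natCast, zpow_ofNat]
    field_simp
  have key := fun j (hj : j ∈ Finset.Iic N) => sum_wellPoised_mul_coeff (b := q / B) (d := a * B)
    hq ha hx hV (by field_simp) hgen hqx haB hc (by rwa [e2]) hw haAB (Finset.mem_Iic.1 hj)
  rw [transformRight]
  simp only [wellPoisedCoeff_mul_nodeFactor hq hA hx, Finset.mul_sum]
  rw [Finset.sum_comm' (t' := Finset.Iic N) (s' := fun j => Finset.Icc j N) (fun k j => by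
    simp only [Finset.mem_Iic, Finset.mem_Icc]
    exact ⟨fun h => ⟨⟨h.2, h.1⟩, h.2.trans h.1⟩, fun h => ⟨h.1.2, h.1.1⟩⟩),
    transformLeft, Finset.mul_sum]
  refine Finset.sum_congr rfl fun j hj => ?_
  simp only [← mul_assoc, ← Finset.sum_mul] at key ⊢
  rw [key j hj, e2, e4, wellPoisedProd]
  simp only [e3]

/-! ### Removal of the genericity condition -/

lemma continuousAt_qRising {f : ℂ → ℂ} {t : ℂ} (hf : ContinuousAt f t) (k : ℕ) :
    ContinuousAt (fun a => qRising q (f a) k) t := by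
  unfold qRising; fun_prop

/-- Functions that are continuous at `t` and agree near `t` off a countable set agree at `t`. -/
lemma eq_of_eventually_eq_off_countable {f g : ℂ → ℂ} {t : ℂ} {S : Set ℂ} (hS : S.Countable)
    (hf : ContinuousAt f t) (hg : ContinuousAt g t)
    (h : ∀ᶠ a in nhds t, a ∉ S → f a = g a) : f t = g t := by
  have hd : Dense Sᶜ := hS.dense_compl ℂ
  have : (nhdsWithin t Sᶜ).NeBot := mem_closure_iff_nhdsWithin_neBot.1 (hd t)
  refine tendsto_nhds_unique_of_eventuallyEq (l := nhdsWithin t Sᶜ)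
    (hf.tendsto.mono_left nhdsWithin_le_nhds)
    (hg.tendsto.mono_left nhdsWithin_le_nhds) ?_
  filter_upwards [mem_nhdsWithin_of_mem_nhds h, self_mem_nhdsWithin] with a h1 h2 using h1 h2

lemma continuousAt_transformLeft (α : (Fin n → ℕ) → ℂ) (ha : a ≠ 0) (hA : A ≠ 0) (hB : B ≠ 0)
    (haA : qRising q (a * A) (multiSum N) ≠ 0)
    (haB : ∀ r, qRising q (a * B * x r) (N r) ≠ 0)
    (haAB : qRising q (q ^ (2 - (multiSum N : ℤ)) / (a * A * B)) (multiSum N) ≠ 0) :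
    ContinuousAt (transformLeft q A B x N α) a := by
  have hw : ContinuousAt (fun a => q ^ (2 - (multiSum N : ℤ)) / (a * A * B)) a :=
    continuousAt_const.div (by fun_prop) (mul_ne_zero (mul_ne_zero ha hA) hB)
  refine ContinuousAt.mul (ContinuousAt.mul ?_ ?_) ?_
  · exact (continuousAt_qRising (by fun_prop) _).div (continuousAt_qRising (by fun_prop) _) haA
  · exact tendsto_finsetProd _ fun r _ => (continuousAt_qRising (by fun_prop) _).div
      (continuousAt_qRising (by fun_prop) _) (haB r)
  · refine tendsto_finsetSum _ fun j hj => ?_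
    refine ContinuousAt.mul (ContinuousAt.mul (continuousAt_const.mul ?_) continuousAt_const)
      continuousAt_const
    exact continuousAt_const.div (continuousAt_qRising hw _)
      (qRising_ne_zero_of_le haAB (multiSum_mono (Finset.mem_Iic.1 hj)))

lemma continuousAt_transformRight (α : (Fin n → ℕ) → ℂ)
    (haA : qRising q (a * A) (multiSum N) ≠ 0)
    (haB : ∀ r, qRising q (a * B * x r) (N r) ≠ 0)
    (hax : ∀ r, 1 - a * x r ≠ 0)
    (haxN : ∀ r, qRising q (a * x r * q ^ (1 + N r)) (multiSum N) ≠ 0) :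
    ContinuousAt (transformRight q A B x N α) a := by
  refine tendsto_finsetSum _ fun k hk => ?_
  have hk := Finset.mem_Iic.1 hk
  have hs := multiSum_mono hk
  refine ContinuousAt.mul (ContinuousAt.mul (ContinuousAt.mul (ContinuousAt.mul
    (continuousAt_const.mul ?_) ?_) (by fun_prop)) continuousAt_const) ?_
  · refine tendsto_finsetProd _ fun r _ => ContinuousAt.div ?_ ?_
      (mul_ne_zero (mul_ne_zero (hax r) (qRising_ne_zero_of_le (haxN r) hs))
        (qRising_ne_zero_of_le (haB r) (hk r)))
    · exact ((by fun_prop : ContinuousAt (fun a => 1 - a * x r * q ^ (k r + multiSum k)) a).mul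
        (continuousAt_qRising (by fun_prop) _)).mul continuousAt_const
    · exact ((by fun_prop : ContinuousAt (fun a => 1 - a * x r) a).mul
        (continuousAt_qRising (by fun_prop) _)).mul (continuousAt_qRising (by fun_prop) _)
  · exact continuousAt_const.div (continuousAt_qRising (by fun_prop) _)
      (qRising_ne_zero_of_le haA hs)
  · refine tendsto_finsetSum _ fun j _ => ?_
    refine ContinuousAt.mul (ContinuousAt.mul (continuousAt_const.mul ?_) continuousAt_const)
      continuousAt_const
    exact tendsto_finsetProd _ fun r _ => continuousAt_qRising (by fun_prop) _

end Transformation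

theorem mainTheorem9 {n : ℕ} (q a A B : ℂ) (x : Fin n → ℂ) (N : Fin n → ℕ)
    (α : (Fin n → ℕ) → ℂ)
    (hq0 : q ≠ 0) (hq1 : ‖q‖ < 1)
    (ha : a ≠ 0) (hA : A ≠ 0) (hB : B ≠ 0) (hx : ∀ r, x r ≠ 0)
    -- no denominator occurring in the identity vanishes
    (hV : ∀ r s, r < s → 1 - x r / x s ≠ 0)
    (hqx : ∀ r s, qRising q (q * (x r / x s)) (N r) ≠ 0)
    (haA : qRising q (a * A) (multiSum N) ≠ 0)
    (haB : ∀ r, qRising q (a * B * x r) (N r) ≠ 0)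
    (haAB : qRising q (q ^ (2 - (multiSum N : ℤ)) / (a * A * B)) (multiSum N) ≠ 0)
    (hax : ∀ r, 1 - a * x r ≠ 0)
    (haxN : ∀ r, qRising q (a * x r * q ^ (1 + N r)) (multiSum N) ≠ 0) :
    (qRising q (a * A * B / q) (multiSum N) / qRising q (a * A) (multiSum N)) *
      (∏ r, qRising q (a * q * x r) (N r) / qRising q (a * B * x r) (N r)) *
      (∑ j ∈ Finset.Iic N,
        vandermondeA q x j *
        (∏ r, ∏ s, qRising q (q ^ (-(N s : ℤ)) * (x r / x s)) (j r)) *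
        (∏ r, qRising q (q * x r / A) (j r)) *
        (qRising q (q / B) (multiSum j) /
          qRising q (q ^ (2 - (multiSum N : ℤ)) / (a * A * B)) (multiSum j)) *
        q ^ (∑ r : Fin n, ((r : ℕ) + 1) * j r) * α j)
    =
    ∑ k ∈ Finset.Iic N,
      vandermondeA q x k *
      (∏ r, ∏ s, qRising q (q ^ (-(N s : ℤ)) * (x r / x s)) (k r) /
        qRising q (q * (x r / x s)) (k r)) *
      (∏ r, ((1 - a * x r * q ^ (k r + multiSum k)) * qRising q (a * x r) (multiSum k) *
          qRising q (q * x r / A) (k r)) /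
        ((1 - a * x r) * qRising q (a * x r * q ^ (1 + N r)) (multiSum k) *
          qRising q (a * B * x r) (k r))) *
      (qRising q (q / B) (multiSum k) / qRising q (a * A) (multiSum k)) *
      (a * A * B * q ^ ((multiSum N : ℤ) - 1)) ^ multiSum k *
      q ^ (∑ r : Fin n, (r : ℕ) * k r) *
      (∑ j ∈ Finset.Iic k,
        vandermondeA q x j *
        (∏ r, ∏ s, qRising q (q ^ (-(k s : ℤ)) * (x r / x s)) (j r)) *
        (∏ r, qRising q (a * x r * q ^ multiSum k) (j r)) *
        q ^ (∑ r : Fin n, ((r : ℕ) + 1) * j r) * α j) := by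
  change transformLeft q A B x N α a = transformRight q A B x N α a
  -- the values of `a` excluded by the genericity condition
  let S : Set ℂ := Set.range fun p : Fin n × ℕ => (x p.1 * q ^ p.2)⁻¹
  refine eq_of_eventually_eq_off_countable (S := S) (Set.countable_range _)
    (continuousAt_transformLeft α ha hA hB haA haB haAB)
    (continuousAt_transformRight α haA haB hax haxN) ?_
  have hw : ContinuousAt (fun a => q ^ (2 - (multiSum N : ℤ)) / (a * A * B)) a :=
    continuousAt_const.div (by fun_prop) (mul_ne_zero (mul_ne_zero ha hA) hB)
  have h1 := continuousAt_id.eventually_ne ha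
  have h2 := (continuousAt_qRising (q := q) (t := a) (f := fun a => a * A) (by fun_prop)
    (multiSum N)).eventually_ne haA
  have h3 := (continuousAt_qRising (q := q) hw (multiSum N)).eventually_ne haAB
  have h4 := Filter.eventually_all.2 fun r => (continuousAt_qRising (q := q) (t := a)
    (f := fun a => a * B * x r) (by fun_prop) (N r)).eventually_ne (haB r)
  filter_upwards [h1, h2, h3, h4] with t h1 h2 h3 h4 ht
  refine transform_of_generic α hq0 h1 hA hB hx hV hqx h2 h4 h3 fun r i h => ht ⟨(r, i), ?_⟩
  exact (eq_inv_of_mul_eq_one_left (by linear_combination -h)).symm
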